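/- Let $G$ be a plane triangulation with $n\ge 4$ nodes, that is, a simple planar graph with a fixed planar embedding in which the boundary of every face (including the external face) is a triangle. The three nodes and three edges on the boundary of the external face are called external, all other nodes and edges internal; let $I$ be the set of internal nodes. Let $R=(T_1,T_2,T_3)$ be a realizer of $G$, that is: (a) the internal edges of $G$ are partitioned into three edge-disjoint trees $T_1,T_2,T_3$, rooted at three distinct external nodes; (b) the neighbors of each $v\in I$ form six blocks $U_1,D_3,U_2,D_1,U_3,D_2$ in counterclockwise order around $v$, where $U_j$ consists of the parent of $v$ in $T_j$ (which exists) and $D_j$ is the (possibly empty) set of children of $v$ in $T_j$. For $v\in I$ let $\mathrm{inter}(v)$ be the number of indices $i\in\{1,2,3\}$ such that $v$ is not a leaf of $T_i$ (a leaf is a node of the rooted tree without children). Call an internal (that is, non-external) face of $G$ cyclic if its boundary contains at least one edge of each of $T_1$, $T_2$, $T_3$, and let $c$ be the number of cyclic faces. Then $$\sum_{v\in I}\mathrm{inter}(v)=n+c-4 .$$ -/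

import Mathlib

/-- A rotation system of a graph: for each node, a cyclic order of the edges around it, read as the
counterclockwise order.  The edge `{v, w}` seen from `v` is the dart `(v, w)`; `rot` sends it to the
counterclockwise next dart at `v`. -/
structure RotationSystem {V : Type*} (G : SimpleGraph V) where
  rot : Equiv.Perm G.Dart
  fst_rot : ∀ d, (rot d).fst = d.fst
  sameCycle_of_fst_eq : ∀ d e : G.Dart, d.fst = e.fst → rot.SameCycle d e

namespace RotationSystem

variable {V : Type*} {G : SimpleGraph V} (S : RotationSystem G)

/-- The dart that follows the dart `(u, v)` on the boundary of the face to the left of `(u, v)`: the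
clockwise next dart after `(v, u)` around `v`. -/
def faceNext : Equiv.Perm G.Dart :=
  (SimpleGraph.Dart.symm_involutive (G := G)).toPerm.trans S.rot.symm

/-- The faces of the embedding are the orbits of `faceNext`; the darts of the orbit traverse the
boundary of the face with the face to their left. -/
def Face : Type _ := Quotient (Equiv.Perm.SameCycle.setoid S.faceNext)

/-- The face to the left of a dart. -/
def leftFace (d : G.Dart) : S.Face := Quotient.mk (Equiv.Perm.SameCycle.setoid S.faceNext) d

end RotationSystem

/-- A plane triangulation on the finite node set `V`: a simple connected graph with a planar
embedding, given combinatorially as a rotation system of genus `0` (that is, Euler's formula holds)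
together with the choice of the external face, such that the boundary of each face is a triangle. -/
structure PlaneTriangulation (V : Type*) [Fintype V] where
  graph : SimpleGraph V
  connected : graph.Connected
  emb : RotationSystem graph
  euler : Nat.card V + Nat.card emb.Face = graph.edgeSet.ncard + 2
  triangle : ∀ d, emb.faceNext (emb.faceNext (emb.faceNext d)) = d
  outer : emb.Face

namespace PlaneTriangulation

variable {V : Type*} [Fintype V] (P : PlaneTriangulation V)

/-- External edges are the edges on the boundary of the external face. -/
def IsExternalEdge (e : Sym2 V) : Prop :=
  ∃ d : P.graph.Dart, P.emb.leftFace d = P.outer ∧ d.edge = e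

/-- Internal edges are the edges that are not external. -/
def IsInternalEdge (e : Sym2 V) : Prop := e ∈ P.graph.edgeSet ∧ ¬ P.IsExternalEdge e

/-- External nodes are the nodes on the boundary of the external face. -/
def IsExternalNode (v : V) : Prop :=
  ∃ d : P.graph.Dart, P.emb.leftFace d = P.outer ∧ d.fst = v

/-- Internal nodes are the nodes that are not external. -/
def IsInternalNode (v : V) : Prop := ¬ P.IsExternalNode v

end PlaneTriangulation

/-- In the tree `T` rooted at `r`, the node `u` is the parent of `v`, and `v` is a child of `u`: they
are adjacent and `v` is one step further away from the root than `u`. -/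
def IsParentIn {V : Type*} {G : SimpleGraph V} (T : G.Subgraph) (r u v : V) : Prop :=
  T.Adj u v ∧ T.spanningCoe.dist r v = T.spanningCoe.dist r u + 1

/-- A leaf of the tree `T` rooted at `r` is a node of `T` without children. -/
def IsLeafIn {V : Type*} {G : SimpleGraph V} (T : G.Subgraph) (r v : V) : Prop :=
  v ∈ T.verts ∧ ∀ w, ¬ IsParentIn T r v w

/-- A realizer of a plane triangulation.  The trees `T₁, T₂, T₃` are `tree 0, tree 1, tree 2`. -/
structure Realizer {V : Type*} [Fintype V] (P : PlaneTriangulation V) where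
  tree : Fin 3 → P.graph.Subgraph
  isTree : ∀ i, (tree i).coe.IsTree
  root : Fin 3 → V
  root_mem : ∀ i, root i ∈ (tree i).verts
  root_external : ∀ i, P.IsExternalNode (root i)
  root_injective : Function.Injective root
  /-- The internal edges are exactly the edges of the three trees. -/
  edges : ∀ e : Sym2 V, P.IsInternalEdge e ↔ ∃ i, e ∈ (tree i).edgeSet
  edge_disjoint : ∀ i j, i ≠ j → Disjoint (tree i).edgeSet (tree j).edgeSet
  /-- Let `v` be an internal node.  With a suitable start, the neighbors of `v`, numbered
  `0, 1, …, deg v - 1` in counterclockwise order, form six consecutive blocks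
  `U₁ = {0}`, `D₃ = {1, …, a - 1}`, `U₂ = {a}`, `D₁ = {a + 1, …, b - 1}`, `U₃ = {b}`,
  `D₂ = {b + 1, …, deg v - 1}`, where `U_j` consists of the parent and `D_j` of the children of `v`
  in `T_j`. -/
  blocks : ∀ v, P.IsInternalNode v → ∃ (d : P.graph.Dart) (a b : ℕ),
    d.fst = v ∧ 0 < a ∧ a < b ∧ b < (P.graph.neighborSet v).ncard ∧
    ∀ k < (P.graph.neighborSet v).ncard,
      (IsParentIn (tree 0) (root 0) ((P.emb.rot ^ k) d).snd v ↔ k = 0) ∧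
      (IsParentIn (tree 2) (root 2) v ((P.emb.rot ^ k) d).snd ↔ 0 < k ∧ k < a) ∧
      (IsParentIn (tree 1) (root 1) ((P.emb.rot ^ k) d).snd v ↔ k = a) ∧
      (IsParentIn (tree 0) (root 0) v ((P.emb.rot ^ k) d).snd ↔ a < k ∧ k < b) ∧
      (IsParentIn (tree 2) (root 2) ((P.emb.rot ^ k) d).snd v ↔ k = b) ∧
      (IsParentIn (tree 1) (root 1) v ((P.emb.rot ^ k) d).snd ↔ b < k)

namespace Realizer

variable {V : Type*} [Fintype V] {P : PlaneTriangulation V} (R : Realizer P)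

open Classical in
/-- The number of the three trees in which `v` is not a leaf. -/
noncomputable def inter (v : V) : ℕ :=
  ∑ i : Fin 3, if ¬ IsLeafIn (R.tree i) (R.root i) v then 1 else 0

/-- A cyclic face is an internal face whose boundary shares an edge with each of the three trees.
(Sharing a node would be no condition, as every internal node lies in all three trees.) -/
def IsCyclicFace (f : P.emb.Face) : Prop :=
  f ≠ P.outer ∧ ∀ i, ∃ d : P.graph.Dart, P.emb.leftFace d = f ∧ d.edge ∈ (R.tree i).edgeSet

/-- The number of cyclic faces. -/
noncomputable def numCyclicFaces : ℕ := {f : P.emb.Face | R.IsCyclicFace f}.ncard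

end Realizer

/-!
Direct every tree edge from the child to the parent. By Euler's formula there are `3 (n - 3)`
internal edges, which is the number of pairs of an internal node `v` and a color `i`; since `v` has a
parent in each tree, every internal edge is the parent edge of exactly one such pair
(`exists_isOut_of_isInternalEdge`), so external nodes have no parents at all.

Count the corners of faces that lie between two parent edges of their node. At an internal node, the
block order says that the parent edges of colors `i + 1` and `i + 2` bound a common corner exactly if
there are no children of color `i`, so these corners correspond to the pairs of an internal node and
a color in which it is a leaf (`ncard_leaves`). On the other hand an internal face has at most one of
them, namely at the node where two of its boundary edges start. Such a node is missing only if the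
boundary is a directed cycle; the block order then makes the colors of successive edges shift by a
constant, so that the face is cyclic (`exists_mem_parentCorners`). If the face has an external edge, both other
edges are internal because `n ≥ 4`, and they start at the node opposite to it. Conversely, in a face with such a
corner the block order forces the third edge, if it is colored at all, to repeat the color of another
edge (`not_isCyclicFace`). So the number of these corners is `2 n - 5 - c`, and the sum of `inter` is
`3 (n - 3) - (2 n - 5 - c)`.
-/

instance SimpleGraph.finite_dart {V : Type*} [Finite V] (G : SimpleGraph V) : Finite G.Dart :=
  Finite.of_injective (fun d => d.toProd) fun _ _ h => SimpleGraph.Dart.ext _ _ h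

namespace RotationSystem

variable {V : Type*} {G : SimpleGraph V} (S : RotationSystem G)

/-! ### Rotations around a node -/

lemma fst_rot_pow (d : G.Dart) (k : ℕ) : ((S.rot ^ k) d).fst = d.fst := by
  induction k with
  | zero => rfl
  | succ k ih => rw [pow_succ', Equiv.Perm.mul_apply, S.fst_rot, ih]

lemma exists_pow_of_fst_eq [Finite V] {d e : G.Dart} (h : d.fst = e.fst) :
    ∃ k : ℕ, (S.rot ^ k) d = e :=
  (S.sameCycle_of_fst_eq d e h).exists_nat_pow_eq

lemma minimalPeriod_rot [Finite V] (d : G.Dart) :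
    Function.minimalPeriod S.rot d = (G.neighborSet d.fst).ncard := by
  have hper : d ∈ Function.periodicPts S.rot :=
    S.rot.injective.mem_periodicPts d
  rw [← Set.ncard_Iio_nat (Function.minimalPeriod S.rot d)]
  refine Set.ncard_congr (fun k _ => ((S.rot ^ k) d).snd) ?_ ?_ ?_
  · intro k _
    rw [SimpleGraph.mem_neighborSet, ← S.fst_rot_pow d k]
    exact ((S.rot ^ k) d).adj
  · intro k l hk hl h
    refine Function.iterate_injOn_Iio_minimalPeriod hk hl ?_
    simp only [Equiv.Perm.iterate_eq_pow]
    exact SimpleGraph.Dart.ext _ _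
      (Prod.ext ((S.fst_rot_pow d k).trans (S.fst_rot_pow d l).symm) h)
  · intro w hw
    obtain ⟨k, hk⟩ := S.exists_pow_of_fst_eq (d := d) (e := ⟨(d.fst, w), hw⟩) rfl
    refine ⟨k % Function.minimalPeriod S.rot d, Set.mem_Iio.2
      (Nat.mod_lt _ (Function.minimalPeriod_pos_of_mem_periodicPts hper)), ?_⟩
    rw [← Equiv.Perm.iterate_eq_pow, Function.iterate_mod_minimalPeriod_eq,
      Equiv.Perm.iterate_eq_pow, hk]

lemma rot_pow_degree [Finite V] (d : G.Dart) :
    (S.rot ^ (G.neighborSet d.fst).ncard) d = d := by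
  rw [← S.minimalPeriod_rot d, ← Equiv.Perm.iterate_eq_pow, Function.iterate_minimalPeriod]

lemma exists_pow_lt_degree [Finite V] {d e : G.Dart} (h : d.fst = e.fst) :
    ∃ k < (G.neighborSet d.fst).ncard, (S.rot ^ k) d = e := by
  obtain ⟨k, hk⟩ := S.exists_pow_of_fst_eq h
  refine ⟨k % Function.minimalPeriod S.rot d, ?_, ?_⟩
  · rw [← S.minimalPeriod_rot d]
    exact Nat.mod_lt _
      (Function.minimalPeriod_pos_of_mem_periodicPts (S.rot.injective.mem_periodicPts d))
  · rw [← Equiv.Perm.iterate_eq_pow, Function.iterate_mod_minimalPeriod_eq,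
      Equiv.Perm.iterate_eq_pow, hk]

/-! ### Faces -/

lemma rot_faceNext (d : G.Dart) : S.rot (S.faceNext d) = d.symm := by
  simp [faceNext]

lemma faceNext_eq_iff {d e : G.Dart} : S.faceNext d = e ↔ S.rot e = d.symm := by
  rw [← S.rot_faceNext d, S.rot.apply_eq_iff_eq, eq_comm]

lemma fst_faceNext (d : G.Dart) : (S.faceNext d).fst = d.snd := by
  rw [← S.fst_rot, rot_faceNext]
  rfl

lemma faceNext_ne (d : G.Dart) : S.faceNext d ≠ d := fun h =>
  d.adj.ne ((congrArg (fun e : G.Dart => e.fst) h).symm.trans (S.fst_faceNext d))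

lemma leftFace_faceNext (d : G.Dart) : S.leftFace (S.faceNext d) = S.leftFace d :=
  Quotient.sound (Equiv.Perm.sameCycle_apply_left.2 (Equiv.Perm.SameCycle.refl _ _))

end RotationSystem

namespace PlaneTriangulation

variable {V : Type*} [Fintype V] (P : PlaneTriangulation V)

instance finite_face : Finite P.emb.Face :=
  inferInstanceAs (Finite (Quotient _))

lemma snd_faceNext_faceNext (d : P.graph.Dart) :
    (P.emb.faceNext (P.emb.faceNext d)).snd = d.fst := by
  rw [← P.emb.fst_faceNext, P.triangle]

lemma snd_faceNext_ne (d : P.graph.Dart) : (P.emb.faceNext d).snd ≠ d.fst := by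
  have := (P.emb.faceNext (P.emb.faceNext d)).adj.ne
  rwa [P.snd_faceNext_faceNext, P.emb.fst_faceNext] at this

lemma faceNext_faceNext_ne (d : P.graph.Dart) : P.emb.faceNext (P.emb.faceNext d) ≠ d := by
  intro h
  have := P.triangle d
  rw [h] at this
  exact P.emb.faceNext_ne d this

lemma leftFace_eq_iff {d e : P.graph.Dart} : P.emb.leftFace d = P.emb.leftFace e ↔
    d = e ∨ d = P.emb.faceNext e ∨ d = P.emb.faceNext (P.emb.faceNext e) := by
  constructor
  · intro h
    have h' : P.emb.faceNext.SameCycle e d := Quotient.exact h.symm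
    obtain ⟨n, rfl⟩ := h'.exists_nat_pow_eq
    clear h h'
    induction n with
    | zero => exact Or.inl rfl
    | succ n ih =>
      rw [pow_succ', Equiv.Perm.mul_apply]
      rcases ih with h | h | h <;> rw [h]
      · exact Or.inr (Or.inl rfl)
      · exact Or.inr (Or.inr rfl)
      · exact Or.inl (P.triangle e)
  · rintro (rfl | rfl | rfl) <;> simp only [RotationSystem.leftFace_faceNext]

lemma ncard_darts_of_face (f : P.emb.Face) : {d | P.emb.leftFace d = f}.ncard = 3 := by
  obtain ⟨e, rfl⟩ := Quotient.exists_rep f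
  rw [Set.ncard_eq_three]
  refine ⟨e, P.emb.faceNext e, P.emb.faceNext (P.emb.faceNext e), (P.emb.faceNext_ne e).symm,
    (P.faceNext_faceNext_ne e).symm, (P.emb.faceNext_ne _).symm, ?_⟩
  ext d
  exact P.leftFace_eq_iff

lemma card_dart_eq_three_mul : Nat.card P.graph.Dart = 3 * Nat.card P.emb.Face := by
  classical
  have := Fintype.ofFinite P.graph.Dart
  have := Fintype.ofFinite P.emb.Face
  rw [Nat.card_eq_fintype_card, Nat.card_eq_fintype_card, ← Finset.card_univ,
    Finset.card_eq_sum_card_fiberwise (f := P.emb.leftFace) (t := Finset.univ) (by simp)]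
  rw [Finset.sum_congr rfl (fun f _ => ?_), Finset.sum_const, Finset.card_univ, smul_eq_mul,
    mul_comm]
  have := P.ncard_darts_of_face f
  rw [Set.ncard_eq_toFinset_card'] at this
  simpa using this

lemma card_dart_eq_two_mul : Nat.card P.graph.Dart = 2 * P.graph.edgeSet.ncard := by
  classical
  rw [Nat.card_eq_fintype_card, SimpleGraph.dart_card_eq_twice_card_edges,
    Set.ncard_eq_toFinset_card', SimpleGraph.edgeFinset]

lemma card_face : Nat.card P.emb.Face + 4 = 2 * Fintype.card V := by
  have h₁ := P.card_dart_eq_three_mul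
  have h₂ := P.card_dart_eq_two_mul
  have h₃ := P.euler
  rw [Nat.card_eq_fintype_card (α := V)] at h₃
  omega

lemma ncard_edgeSet : P.graph.edgeSet.ncard + 6 = 3 * Fintype.card V := by
  have h₁ := P.card_dart_eq_three_mul
  have h₂ := P.card_dart_eq_two_mul
  have h₃ := P.card_face
  omega

/-! ### External and internal nodes and edges -/

lemma isExternalEdge_iff {d : P.graph.Dart} : P.IsExternalEdge d.edge ↔
    P.emb.leftFace d = P.outer ∨ P.emb.leftFace d.symm = P.outer := by
  constructor
  · rintro ⟨e, he, h⟩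
    rcases (SimpleGraph.dart_edge_eq_iff e d).1 h with rfl | rfl
    · exact Or.inl he
    · exact Or.inr he
  · rintro (h | h)
    · exact ⟨d, h, rfl⟩
    · exact ⟨d.symm, h, d.edge_symm⟩

lemma IsExternalEdge.fst {P : PlaneTriangulation V} {d : P.graph.Dart}
    (h : P.IsExternalEdge d.edge) : P.IsExternalNode d.fst := by
  rcases P.isExternalEdge_iff.1 h with h | h
  · exact ⟨d, h, rfl⟩
  · exact ⟨P.emb.faceNext d.symm, by rw [RotationSystem.leftFace_faceNext, h],
      P.emb.fst_faceNext _⟩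

lemma IsExternalEdge.snd {P : PlaneTriangulation V} {d : P.graph.Dart}
    (h : P.IsExternalEdge d.edge) : P.IsExternalNode d.snd := by
  rw [← d.edge_symm] at h
  exact h.fst

lemma isInternalEdge_iff {d : P.graph.Dart} :
    P.IsInternalEdge d.edge ↔ ¬ P.IsExternalEdge d.edge :=
  and_iff_right d.edge_mem

lemma ncard_externalNodes : {v | P.IsExternalNode v}.ncard = 3 := by
  rw [← P.ncard_darts_of_face P.outer]
  symm
  refine Set.ncard_congr (fun d _ => d.fst) (fun d hd => ⟨d, hd, rfl⟩) ?_
    (fun v ⟨d, hd, h⟩ => ⟨d, hd, h⟩)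
  intro d e hd he h
  rcases P.leftFace_eq_iff.1 (hd.trans he.symm) with h' | h' | h'
  · exact h'
  · subst h'
    exact absurd ((P.emb.fst_faceNext e).symm.trans h).symm e.adj.ne
  · subst h'
    have := P.snd_faceNext_faceNext e
    exact absurd (h.trans this.symm) (P.emb.faceNext (P.emb.faceNext e)).adj.ne

/-- No face lies on both sides of an edge, since its boundary has three distinct nodes. -/
lemma leftFace_symm_ne (d : P.graph.Dart) : P.emb.leftFace d.symm ≠ P.emb.leftFace d := by
  intro h
  rcases P.leftFace_eq_iff.1 h with h | h | h
  · exact d.symm_ne h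
  · exact P.snd_faceNext_ne d (congrArg (fun e : P.graph.Dart => e.snd) h).symm
  · have h' : d.snd = _ := congrArg (fun e : P.graph.Dart => e.fst) h
    rw [P.emb.fst_faceNext, ← P.emb.fst_faceNext d] at h'
    exact (P.emb.faceNext d).adj.ne h'

lemma ncard_externalEdges : {e | P.IsExternalEdge e}.ncard = 3 := by
  rw [← P.ncard_darts_of_face P.outer]
  symm
  refine Set.ncard_congr (fun d _ => d.edge) (fun d hd => ⟨d, hd, rfl⟩) ?_
    (fun v ⟨d, hd, h⟩ => ⟨d, hd, h⟩)
  intro d e hd he h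
  rcases (SimpleGraph.dart_edge_eq_iff d e).1 h with h' | h'
  · exact h'
  · subst h'
    exact absurd (hd.trans he.symm) (P.leftFace_symm_ne e)

lemma ncard_internalNodes : {v | P.IsInternalNode v}.ncard + 3 = Fintype.card V := by
  rw [← P.ncard_externalNodes, ← Nat.card_eq_fintype_card, add_comm]
  exact Set.ncard_add_ncard_compl _

lemma ncard_internalEdges :
    {e | P.IsInternalEdge e}.ncard = 3 * {v | P.IsInternalNode v}.ncard := by
  have h₁ := P.ncard_edgeSet
  have h₂ := P.ncard_internalNodes
  have h₃ := P.ncard_externalEdges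
  have hsub : {e | P.IsExternalEdge e} ⊆ P.graph.edgeSet := by
    rintro _ ⟨d, -, rfl⟩
    exact d.edge_mem
  have h₄ := Set.ncard_sdiff_add_ncard_of_subset hsub
  have h₅ : {e | P.IsInternalEdge e} = P.graph.edgeSet \ {e | P.IsExternalEdge e} := rfl
  rw [h₅]
  omega

/-- If the reverses of two consecutive edges of a face are again consecutive on a face, then the
triangulation consists of a single triangle. -/
lemma card_le_three_of_faceNext_symm {d : P.graph.Dart}
    (h : P.emb.faceNext (P.emb.faceNext d).symm = d.symm) : Fintype.card V ≤ 3 := by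
  classical
  -- At the end of such a dart `d` only two darts start, namely `d.symm` and `faceNext d`.
  have key : ∀ d : P.graph.Dart, P.emb.faceNext (P.emb.faceNext d).symm = d.symm →
      ∀ w, P.graph.Adj d.snd w → w = d.fst ∨ w = (P.emb.faceNext d).snd := by
    intro d h w hw
    rw [P.emb.faceNext_eq_iff, SimpleGraph.Dart.symm_symm] at h
    obtain ⟨k, hk⟩ := P.emb.exists_pow_of_fst_eq (d := d.symm) (e := ⟨(d.snd, w), hw⟩) rfl
    have : ∀ k : ℕ, (P.emb.rot ^ k) d.symm = d.symm ∨
        (P.emb.rot ^ k) d.symm = P.emb.faceNext d := by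
      intro k
      induction k with
      | zero => exact Or.inl rfl
      | succ k ih =>
        rw [pow_succ', Equiv.Perm.mul_apply]
        rcases ih with ih | ih <;> rw [ih]
        · exact Or.inr h
        · exact Or.inl (P.emb.rot_faceNext d)
    rcases this k with h' | h' <;> rw [hk] at h'
    · exact Or.inl (congrArg (fun e : P.graph.Dart => e.snd) h')
    · exact Or.inr (congrArg (fun e : P.graph.Dart => e.snd) h')
  -- The reversed darts form a face as well, so the same holds at the two other nodes of the face.
  have h₃ : P.emb.faceNext d.symm = (P.emb.faceNext (P.emb.faceNext d)).symm := by
    refine SimpleGraph.Dart.ext _ _ (Prod.ext ?_ ?_)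
    · exact (P.emb.fst_faceNext _).trans (P.snd_faceNext_faceNext d).symm
    · rw [← h]
      refine (P.snd_faceNext_faceNext _).trans ?_
      exact (P.emb.fst_faceNext (P.emb.faceNext d)).symm
  have h₂ : P.emb.faceNext (P.emb.faceNext (P.emb.faceNext d)).symm = (P.emb.faceNext d).symm := by
    rw [← h₃, ← h, P.triangle]
  have k₁ := key d h
  have k₂ := key _ h₂
  have k₃ := key (P.emb.faceNext (P.emb.faceNext d)) (by rw [P.triangle]; exact h₃)
  rw [P.triangle, P.emb.fst_faceNext, P.snd_faceNext_faceNext] at k₃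
  rw [P.emb.fst_faceNext, P.snd_faceNext_faceNext] at k₂
  have hcl : ∀ v w, P.graph.Walk v w → v ∈ ({d.fst, d.snd, (P.emb.faceNext d).snd} : Finset V) →
      w ∈ ({d.fst, d.snd, (P.emb.faceNext d).snd} : Finset V) := by
    intro v w p
    induction p with
    | nil => exact id
    | cons hadj p ih =>
      intro hv
      refine ih ?_
      simp only [Finset.mem_insert, Finset.mem_singleton] at hv ⊢
      rcases hv with rfl | rfl | rfl
      · have := k₃ _ hadj; tauto
      · have := k₁ _ hadj; tauto
      · have := k₂ _ hadj; tauto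
  calc Fintype.card V = (Finset.univ : Finset V).card := rfl
    _ ≤ ({d.fst, d.snd, (P.emb.faceNext d).snd} : Finset V).card := by
      refine Finset.card_le_card fun w _ => ?_
      obtain ⟨p⟩ := P.connected.preconnected d.fst w
      exact hcl _ _ p (by simp)
    _ ≤ 3 := Finset.card_le_three

/-- With at least four nodes, an internal face has at most one external edge: otherwise it would be
the reverse of the external face and there would be no further nodes. -/
lemma not_isExternalEdge_faceNext (hn : 4 ≤ Fintype.card V) {d : P.graph.Dart}
    (hd : P.emb.leftFace d ≠ P.outer) (h : P.IsExternalEdge d.edge) :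
    ¬ P.IsExternalEdge (P.emb.faceNext d).edge := by
  intro h'
  have h₁ := (P.isExternalEdge_iff.1 h).resolve_left hd
  have h₂ := (P.isExternalEdge_iff.1 h').resolve_left (by rwa [RotationSystem.leftFace_faceNext])
  rcases P.leftFace_eq_iff.1 (h₁.trans h₂.symm) with e | e | e
  · have h₃ : d.snd = (P.emb.faceNext d).snd := congrArg (fun e : P.graph.Dart => e.fst) e
    exact (P.emb.faceNext d).adj.ne ((P.emb.fst_faceNext d).trans h₃)
  · exact absurd (P.card_le_three_of_faceNext_symm e.symm) (by omega)
  · have h₃ : d.fst = _ := congrArg (fun e : P.graph.Dart => e.snd) e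
    rw [P.snd_faceNext_faceNext] at h₃
    exact P.snd_faceNext_ne d h₃.symm

end PlaneTriangulation

namespace Realizer

variable {V : Type*} [Fintype V] {P : PlaneTriangulation V} (R : Realizer P)

/-! ### Colored and oriented edges -/

/-- The dart `d` is outgoing in color `i`: it leads from its first node to the parent of that node in
the `i`-th tree. -/
def IsOut (i : Fin 3) (d : P.graph.Dart) : Prop :=
  IsParentIn (R.tree i) (R.root i) d.snd d.fst

variable {R}

lemma IsOut.mem_edgeSet {i : Fin 3} {d : P.graph.Dart} (h : R.IsOut i d) :
    d.edge ∈ (R.tree i).edgeSet :=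
  SimpleGraph.Subgraph.mem_edgeSet.2 h.1.symm

lemma IsOut.mem_edgeSet_symm {i : Fin 3} {d : P.graph.Dart} (h : R.IsOut i d.symm) :
    d.edge ∈ (R.tree i).edgeSet :=
  d.edge_symm ▸ h.mem_edgeSet

lemma color_unique {i j : Fin 3} {e : Sym2 V} (hi : e ∈ (R.tree i).edgeSet)
    (hj : e ∈ (R.tree j).edgeSet) : i = j := by
  by_contra h
  exact Set.disjoint_left.1 (R.edge_disjoint i j h) hi hj

lemma IsOut.isInternalEdge {i : Fin 3} {d : P.graph.Dart} (h : R.IsOut i d) :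
    P.IsInternalEdge d.edge :=
  (R.edges _).2 ⟨i, h.mem_edgeSet⟩

lemma IsOut.color_eq {i j : Fin 3} {d : P.graph.Dart} (h : R.IsOut i d) (h' : R.IsOut j d) :
    i = j :=
  color_unique h.mem_edgeSet h'.mem_edgeSet

lemma IsOut.not_symm {i j : Fin 3} {d : P.graph.Dart} (h : R.IsOut i d) : ¬ R.IsOut j d.symm := by
  intro h'
  obtain rfl := color_unique h.mem_edgeSet h'.mem_edgeSet_symm
  have h₁ := h.2
  have h₂ : _ = _ := h'.2
  change (R.tree i).spanningCoe.dist (R.root i) d.snd =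
    (R.tree i).spanningCoe.dist (R.root i) d.fst + 1 at h₂
  omega

variable (R)

/-- The block condition at an internal node in terms of outgoing darts; `N` is the degree. -/
lemma exists_blocks {v : V} (hv : P.IsInternalNode v) : ∃ (d : P.graph.Dart) (a b N : ℕ),
    d.fst = v ∧ 0 < a ∧ a < b ∧ b < N ∧ (P.emb.rot ^ N) d = d ∧
    (∀ e : P.graph.Dart, e.fst = v → ∃ k < N, (P.emb.rot ^ k) d = e) ∧
    ∀ k < N,
      (R.IsOut 0 ((P.emb.rot ^ k) d) ↔ k = 0) ∧
      (R.IsOut 2 ((P.emb.rot ^ k) d).symm ↔ 0 < k ∧ k < a) ∧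
      (R.IsOut 1 ((P.emb.rot ^ k) d) ↔ k = a) ∧
      (R.IsOut 0 ((P.emb.rot ^ k) d).symm ↔ a < k ∧ k < b) ∧
      (R.IsOut 2 ((P.emb.rot ^ k) d) ↔ k = b) ∧
      (R.IsOut 1 ((P.emb.rot ^ k) d).symm ↔ b < k) := by
  obtain ⟨d, a, b, rfl, ha, hab, hb, h⟩ := R.blocks v hv
  refine ⟨d, a, b, _, rfl, ha, hab, hb, P.emb.rot_pow_degree d,
    fun e he => P.emb.exists_pow_lt_degree he.symm, fun k hk => ?_⟩
  have h' := h k hk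
  rw [← P.emb.fst_rot_pow d k] at h'
  exact h'

lemma existsUnique_isOut {v : V} (hv : P.IsInternalNode v) (i : Fin 3) :
    ∃! d : P.graph.Dart, d.fst = v ∧ R.IsOut i d := by
  obtain ⟨d, a, b, N, hd, ha, hab, hb, -, hk, h⟩ := R.exists_blocks hv
  have key : ∃ m < N, ∀ k < N, R.IsOut i ((P.emb.rot ^ k) d) ↔ k = m := by
    fin_cases i
    · exact ⟨0, by omega, fun k hk => (h k hk).1⟩
    · exact ⟨a, by omega, fun k hk => (h k hk).2.2.1⟩
    · exact ⟨b, by omega, fun k hk => (h k hk).2.2.2.2.1⟩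
  obtain ⟨m, hm, key⟩ := key
  refine ⟨(P.emb.rot ^ m) d, ⟨(P.emb.fst_rot_pow d m).trans hd, (key m hm).2 rfl⟩, ?_⟩
  rintro e ⟨he, ho⟩
  obtain ⟨k, hkN, rfl⟩ := hk e he
  rw [(key k hkN).1 ho]

/-- Next to the parent edge of color `i` comes, counterclockwise, the parent edge of color `i + 1` if
there are no children of color `i + 2`, and an edge to such a child otherwise. -/
lemma isOut_rot_of_isOut {d : P.graph.Dart} (hd : P.IsInternalNode d.fst) {i : Fin 3}
    (h : R.IsOut i d) :
    (R.IsOut (i + 1) (P.emb.rot d) ∧ ∀ e : P.graph.Dart, e.fst = d.fst → ¬ R.IsOut (i + 2) e.symm) ∨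
      R.IsOut (i + 2) (P.emb.rot d).symm := by
  obtain ⟨d₀, a, b, N, -, ha, hab, hb, hN, hk, hB⟩ := R.exists_blocks hd
  obtain ⟨k, hkN, rfl⟩ := hk d rfl
  rw [← Equiv.Perm.mul_apply, ← pow_succ']
  have h0 := hB 0 (by omega)
  have hkk := hB k hkN
  match i, h with
  | 0, h =>
    obtain rfl := hkk.1.1 h
    rcases (show 0 + 1 = a ∨ 0 + 1 < a by omega) with h1 | h1
    · refine Or.inl ⟨(hB _ (by omega)).2.2.1.2 h1, fun e he ho => ?_⟩
      obtain ⟨m, hm, rfl⟩ := hk e he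
      have := (hB m hm).2.1.1 ho
      omega
    · exact Or.inr ((hB _ (by omega)).2.1.2 (by omega))
  | 1, h =>
    obtain rfl := hkk.2.2.1.1 h
    rcases (show k + 1 = b ∨ k + 1 < b by omega) with h1 | h1
    · refine Or.inl ⟨(hB _ (by omega)).2.2.2.2.1.2 h1, fun e he ho => ?_⟩
      obtain ⟨m, hm, rfl⟩ := hk e he
      have := (hB m hm).2.2.2.1.1 ho
      omega
    · exact Or.inr ((hB _ (by omega)).2.2.2.1.2 (by omega))
  | 2, h =>
    obtain rfl := hkk.2.2.2.2.1.1 h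
    rcases (show k + 1 = N ∨ k + 1 < N by omega) with h1 | h1
    · refine Or.inl ⟨?_, fun e he ho => ?_⟩
      · rw [h1, hN]
        exact h0.1.2 rfl
      · obtain ⟨m, hm, rfl⟩ := hk e he
        have := (hB m hm).2.2.2.2.2.1 ho
        omega
    · exact Or.inr ((hB _ h1).2.2.2.2.2.2 (by omega))

/-- Next to an edge to a child of color `i` comes, counterclockwise, another such edge or the parent
edge of color `i + 2`. -/
lemma isOut_rot_of_isOut_symm {d : P.graph.Dart} (hd : P.IsInternalNode d.fst) {i : Fin 3}
    (h : R.IsOut i d.symm) :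
    R.IsOut i (P.emb.rot d).symm ∨ R.IsOut (i + 2) (P.emb.rot d) := by
  obtain ⟨d₀, a, b, N, -, ha, hab, hb, hN, hk, hB⟩ := R.exists_blocks hd
  obtain ⟨k, hkN, rfl⟩ := hk d rfl
  rw [← Equiv.Perm.mul_apply, ← pow_succ']
  have hkk := hB k hkN
  match i, h with
  | 0, h =>
    have h1 := hkk.2.2.2.1.1 h
    rcases (show k + 1 = b ∨ k + 1 < b by omega) with h2 | h2
    · exact Or.inr ((hB _ (by omega)).2.2.2.2.1.2 h2)
    · exact Or.inl ((hB _ (by omega)).2.2.2.1.2 (by omega))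
  | 1, h =>
    have h1 := hkk.2.2.2.2.2.1 h
    rcases (show k + 1 = N ∨ k + 1 < N by omega) with h2 | h2
    · refine Or.inr ?_
      rw [h2, hN]
      exact (hB 0 (by omega)).1.2 rfl
    · exact Or.inl ((hB _ h2).2.2.2.2.2.2 (by omega))
  | 2, h =>
    have h1 := hkk.2.1.1 h
    rcases (show k + 1 = a ∨ k + 1 < a by omega) with h2 | h2
    · exact Or.inr ((hB _ (by omega)).2.2.1.2 h2)
    · exact Or.inl ((hB _ (by omega)).2.1.2 (by omega))

/-- Every internal edge leads from an internal node to one of its parents.  There are `3 (n - 3)`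
internal edges by Euler's formula, and as many pairs of an internal node and a color; sending such a
pair to the parent edge is injective, hence surjective. -/
lemma exists_isOut_of_isInternalEdge {d : P.graph.Dart} (hd : P.IsInternalEdge d.edge) :
    ∃ i, (P.IsInternalNode d.fst ∧ R.IsOut i d) ∨ (P.IsInternalNode d.snd ∧ R.IsOut i d.symm) := by
  choose par hpar using fun (v : {v // P.IsInternalNode v}) i => (R.existsUnique_isOut v.2 i).exists
  let f : {v // P.IsInternalNode v} × Fin 3 → {e // P.IsInternalEdge e} := fun p =>
    ⟨(par p.1 p.2).edge, (hpar p.1 p.2).2.isInternalEdge⟩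
  have hinj : Function.Injective f := by
    rintro ⟨v, i⟩ ⟨w, j⟩ h
    have hv := hpar v i
    have hw := hpar w j
    rcases (SimpleGraph.dart_edge_eq_iff _ _).1 (congrArg Subtype.val h) with h' | h'
    all_goals dsimp only at h'
    · rw [h'] at hv
      have h₁ : v = w := Subtype.ext (hv.1.symm.trans hw.1)
      have h₂ : i = j := hv.2.color_eq hw.2
      rw [h₁, h₂]
    · rw [h'] at hv
      exact absurd hv.2 hw.2.not_symm
  have hcard : Nat.card ({v // P.IsInternalNode v} × Fin 3) = Nat.card {e // P.IsInternalEdge e} := by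
    rw [Nat.card_prod, Nat.card_fin, mul_comm]
    exact P.ncard_internalEdges.symm
  obtain ⟨⟨v, i⟩, h⟩ := ((Nat.bijective_iff_injective_and_card f).2 ⟨hinj, hcard⟩).2 ⟨_, hd⟩
  have hv := hpar v i
  refine ⟨i, ?_⟩
  rcases (SimpleGraph.dart_edge_eq_iff _ _).1 (congrArg Subtype.val h) with h' | h'
  all_goals
    dsimp only at h'
    rw [h'] at hv
  · exact Or.inl ⟨hv.1 ▸ v.2, hv.2⟩
  · refine Or.inr ⟨?_, hv.2⟩
    have h₁ : d.snd = v := hv.1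
    exact h₁ ▸ v.2

variable {R}

lemma IsOut.isInternalNode {i : Fin 3} {d : P.graph.Dart} (h : R.IsOut i d) :
    P.IsInternalNode d.fst := by
  obtain ⟨j, h' | h'⟩ := R.exists_isOut_of_isInternalEdge h.isInternalEdge
  · exact h'.1
  · exact absurd h'.2 h.not_symm

variable (R)

lemma isOut_or_isOut_symm {d : P.graph.Dart} (hd : P.IsInternalEdge d.edge) :
    (∃ i, R.IsOut i d) ∨ ∃ i, R.IsOut i d.symm := by
  obtain ⟨i, h | h⟩ := R.exists_isOut_of_isInternalEdge hd
  · exact Or.inl ⟨i, h.2⟩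
  · exact Or.inr ⟨i, h.2⟩

/-! ### Corners between two parent edges -/

/-- The darts `d` such that both `d` and the counterclockwise next dart lead to parents.  They stand
for the corners that lie between two parent edges. -/
def parentCorners : Set P.graph.Dart :=
  {d | (∃ i, R.IsOut i d) ∧ ∃ j, R.IsOut j (P.emb.rot d)}

lemma isLeafIn_iff {v : V} (hv : P.IsInternalNode v) (i : Fin 3) :
    IsLeafIn (R.tree i) (R.root i) v ↔ ∀ e : P.graph.Dart, e.fst = v → ¬ R.IsOut i e.symm := by
  constructor
  · rintro ⟨-, h⟩ e rfl ho
    exact h _ ho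
  · intro h
    obtain ⟨d, ⟨rfl, hd⟩, -⟩ := R.existsUnique_isOut hv i
    exact ⟨(R.tree i).edge_vert hd.1.symm, fun w hw =>
      h ⟨(d.fst, w), (R.tree i).adj_sub hw.1⟩ rfl hw⟩

/-- A node is a leaf in color `i` exactly if its parent edges of the two other colors bound a common
corner. -/
lemma ncard_leaves : {p : V × Fin 3 | P.IsInternalNode p.1 ∧
      IsLeafIn (R.tree p.2) (R.root p.2) p.1}.ncard = R.parentCorners.ncard := by
  choose par hpar using fun (v : V) (hv : P.IsInternalNode v) i => (R.existsUnique_isOut hv i)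
  have hcol : ∀ i : Fin 3, i + 1 + 2 = i := by decide
  refine Set.ncard_congr (fun p hp => par p.1 hp.1 (p.2 + 1)) ?_ ?_ ?_
  · rintro ⟨v, i⟩ ⟨hv, hl⟩
    obtain ⟨h₁, h₂⟩ := (hpar v hv (i + 1)).1
    have hl' := (R.isLeafIn_iff hv i).1 hl
    refine ⟨⟨_, h₂⟩, ?_⟩
    rcases R.isOut_rot_of_isOut h₂.isInternalNode h₂ with h | h
    · exact ⟨_, h.1⟩
    · rw [hcol] at h
      exact absurd h (hl' _ ((P.emb.fst_rot _).trans h₁))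
  · rintro ⟨v, i⟩ ⟨w, j⟩ ⟨hv, _⟩ ⟨hw, _⟩ h
    obtain ⟨h₁, h₂⟩ := (hpar v hv (i + 1)).1
    obtain ⟨h₃, h₄⟩ := (hpar w hw (j + 1)).1
    dsimp only at h
    rw [h] at h₁ h₂
    exact Prod.ext (h₁.symm.trans h₃) (add_right_cancel (h₂.color_eq h₄))
  · rintro d ⟨⟨i, hi⟩, j, hj⟩
    have hd := hi.isInternalNode
    have hcol' : ∀ i : Fin 3, i + 2 + 1 = i := by decide
    refine ⟨(d.fst, i + 2), ⟨hd, ?_⟩, ?_⟩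
    · rw [R.isLeafIn_iff hd]
      rcases R.isOut_rot_of_isOut hd hi with h | h
      · exact h.2
      · exact absurd h hj.not_symm
    · exact ((hpar d.fst hd (i + 2 + 1)).2 d ⟨rfl, by rwa [hcol']⟩).symm

lemma rot_eq_symm (d : P.graph.Dart) :
    P.emb.rot d = (P.emb.faceNext (P.emb.faceNext d)).symm := by
  rw [← P.emb.rot_faceNext, P.triangle]

/-- The third edge of a face with a corner between parent edges has the color of one of these. -/
lemma not_isCyclicFace {d : P.graph.Dart} (hd : d ∈ R.parentCorners) :
    ¬ R.IsCyclicFace (P.emb.leftFace d) := by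
  obtain ⟨⟨i, hi⟩, j, hj⟩ := hd
  have hij : j = i + 1 := by
    rcases R.isOut_rot_of_isOut hi.isInternalNode hi with h | h
    · exact hj.color_eq h.1
    · exact absurd h hj.not_symm
  subst hij
  rw [rot_eq_symm] at hj
  have n₁ : ∀ i : Fin 3, i + 2 ≠ i := by decide
  have n₂ : ∀ i : Fin 3, i + 2 ≠ i + 1 := by decide
  have n₃ : ∀ i : Fin 3, i ≠ i + 2 + 2 := by decide
  have n₄ : ∀ i : Fin 3, i + 2 ≠ i + 1 + 2 := by decide
  rintro ⟨-, h⟩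
  obtain ⟨e, he, hcol⟩ := h (i + 2)
  rcases P.leftFace_eq_iff.1 he with rfl | rfl | rfl
  · exact n₁ i (color_unique hcol hi.mem_edgeSet)
  · obtain ⟨k, hk⟩ | ⟨k, hk⟩ := R.isOut_or_isOut_symm ((R.edges _).2 ⟨_, hcol⟩)
    · obtain rfl := color_unique hcol hk.mem_edgeSet
      have h := R.isOut_rot_of_isOut hk.isInternalNode hk
      rw [P.emb.rot_faceNext] at h
      rcases h with h | h
      · exact hi.not_symm h.1
      · exact n₃ i (hi.color_eq h)
    · obtain rfl := color_unique hcol hk.mem_edgeSet_symm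
      have hint := hk.isInternalNode
      rw [← P.emb.rot_faceNext, P.emb.fst_rot] at hint
      have h := R.isOut_rot_of_isOut_symm hint hj
      rw [P.emb.rot_faceNext] at h
      rcases h with h | h
      · exact hk.not_symm h
      · exact n₄ i (hk.color_eq h)
  · exact n₂ i (color_unique hcol hj.mem_edgeSet_symm)

lemma leftFace_ne_outer {d : P.graph.Dart} (hd : d ∈ R.parentCorners) :
    P.emb.leftFace d ≠ P.outer := by
  obtain ⟨⟨i, hi⟩, -⟩ := hd
  exact fun h => hi.isInternalEdge.2 ⟨d, h, rfl⟩

lemma leftFace_injOn : Set.InjOn P.emb.leftFace R.parentCorners := by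
  rintro d ⟨⟨i, hi⟩, j, hj⟩ e ⟨⟨k, hk⟩, l, hl⟩ h
  rcases P.leftFace_eq_iff.1 h with h | rfl | rfl
  · exact h
  · rw [P.emb.rot_faceNext] at hj
    exact absurd hj hk.not_symm
  · rw [rot_eq_symm] at hl
    exact absurd hl hi.not_symm

variable {R}

lemma IsOut.mem_parentCorners {i j : Fin 3} {d : P.graph.Dart} (h : R.IsOut i d)
    (h' : R.IsOut j (P.emb.faceNext (P.emb.faceNext d)).symm) : d ∈ R.parentCorners :=
  ⟨⟨i, h⟩, j, by rwa [rot_eq_symm]⟩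

variable (R)

/-- Both internal edges of a face with an external edge leave the node opposite to that edge, as the
nodes of the external edge have no parents. -/
lemma mem_parentCorners_of_isExternalEdge (hn : 4 ≤ Fintype.card V) {d : P.graph.Dart}
    (hd : P.emb.leftFace d ≠ P.outer) (h : P.IsExternalEdge d.edge) :
    P.emb.faceNext (P.emb.faceNext d) ∈ R.parentCorners := by
  have h₂ : P.IsInternalEdge (P.emb.faceNext d).edge :=
    P.isInternalEdge_iff.2 (P.not_isExternalEdge_faceNext hn hd h)
  have h₃ : P.IsInternalEdge (P.emb.faceNext (P.emb.faceNext d)).edge := by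
    refine P.isInternalEdge_iff.2 fun h' => ?_
    refine P.not_isExternalEdge_faceNext hn ?_ h' ((P.triangle d).symm ▸ h)
    simpa only [RotationSystem.leftFace_faceNext] using hd
  obtain ⟨i, hi⟩ | ⟨i, hi⟩ := R.isOut_or_isOut_symm h₂
  · refine absurd h.snd ?_
    rw [← P.emb.fst_faceNext]
    exact hi.isInternalNode
  obtain ⟨j, hj⟩ | ⟨j, hj⟩ := R.isOut_or_isOut_symm h₃
  · exact hj.mem_parentCorners (by rwa [P.triangle])
  · refine absurd h.fst ?_
    rw [← P.snd_faceNext_faceNext]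
    exact hj.isInternalNode

/-- A face whose boundary is a directed cycle is cyclic: the colors of consecutive edges differ by a
fixed shift.  In every other face some node is the start of two boundary edges. -/
lemma exists_mem_parentCorners (hn : 4 ≤ Fintype.card V) {f : P.emb.Face} (hf : f ≠ P.outer)
    (hc : ¬ R.IsCyclicFace f) : ∃ d ∈ R.parentCorners, P.emb.leftFace d = f := by
  obtain ⟨d, rfl⟩ : ∃ d, P.emb.leftFace d = f := Quotient.exists_rep f
  have l₂ := P.emb.leftFace_faceNext d
  have l₃ := (P.emb.leftFace_faceNext (P.emb.faceNext d)).trans l₂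
  have r₂ := P.emb.rot_faceNext d
  have r₃ := P.emb.rot_faceNext (P.emb.faceNext d)
  have t := P.triangle d
  have ext := fun e => R.mem_parentCorners_of_isExternalEdge (d := e) hn
  have e₁ := ext d
  have e₂ := ext (P.emb.faceNext d)
  have e₃ := ext (P.emb.faceNext (P.emb.faceNext d))
  have m₁ := fun i j => IsOut.mem_parentCorners (R := R) (i := i) (j := j) (d := d)
  have m₂ := fun i j => IsOut.mem_parentCorners (R := R) (i := i) (j := j) (d := P.emb.faceNext d)
  have m₃ := fun i j => IsOut.mem_parentCorners (R := R) (i := i) (j := j)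
    (d := P.emb.faceNext (P.emb.faceNext d))
  rw [t] at e₂ e₃ m₂ m₃
  -- From here on the boundary of the face is the abstract triangle `d, d₂, d₃`.
  generalize hd₂ : P.emb.faceNext d = d₂ at *
  generalize hd₃ : P.emb.faceNext d₂ = d₃ at *
  by_cases x₁ : P.IsExternalEdge d.edge
  · exact ⟨_, e₁ hf x₁, l₃⟩
  by_cases x₂ : P.IsExternalEdge d₂.edge
  · exact ⟨_, e₂ (l₂ ▸ hf) x₂, rfl⟩
  by_cases x₃ : P.IsExternalEdge d₃.edge
  · exact ⟨_, e₃ (l₃ ▸ hf) x₃, l₂⟩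
  have hcol : ∀ c i j k : Fin 3, i = j + 2 → j = k + 2 → c = i ∨ c = j ∨ c = k := by decide
  have cyc : ∀ i j k, i = j + 2 → j = k + 2 → d.edge ∈ (R.tree i).edgeSet →
      d₂.edge ∈ (R.tree j).edgeSet → d₃.edge ∈ (R.tree k).edgeSet → False := by
    intro i j k hij hjk hi hj hk
    refine hc ⟨hf, fun c => ?_⟩
    rcases hcol c i j k hij hjk with rfl | rfl | rfl
    · exact ⟨d, rfl, hi⟩
    · exact ⟨d₂, l₂, hj⟩
    · exact ⟨d₃, l₃, hk⟩
  -- Orient the three edges: only the first and the last of the eight cases are directed cycles.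
  obtain ⟨i, hi⟩ | ⟨i, hi⟩ := R.isOut_or_isOut_symm (P.isInternalEdge_iff.2 x₁) <;>
  obtain ⟨j, hj⟩ | ⟨j, hj⟩ := R.isOut_or_isOut_symm (P.isInternalEdge_iff.2 x₂) <;>
  obtain ⟨k, hk⟩ | ⟨k, hk⟩ := R.isOut_or_isOut_symm (P.isInternalEdge_iff.2 x₃)
  · have h₂ := R.isOut_rot_of_isOut hj.isInternalNode hj
    have h₃ := R.isOut_rot_of_isOut hk.isInternalNode hk
    rw [r₂] at h₂
    rw [r₃] at h₃
    exact (cyc i j k (hi.color_eq (h₂.resolve_left fun h => hi.not_symm h.1))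
      (hj.color_eq (h₃.resolve_left fun h => hj.not_symm h.1))
      hi.mem_edgeSet hj.mem_edgeSet hk.mem_edgeSet).elim
  · exact ⟨_, m₁ _ _ hi hk, rfl⟩
  · exact ⟨_, m₃ _ _ hk hj, l₃⟩
  · exact ⟨_, m₁ _ _ hi hk, rfl⟩
  · exact ⟨_, m₂ _ _ hj hi, l₂⟩
  · exact ⟨_, m₂ _ _ hj hi, l₂⟩
  · exact ⟨_, m₃ _ _ hk hj, l₃⟩
  · have n₂ := hi.isInternalNode
    have n₃ := hj.isInternalNode
    rw [← r₂, P.emb.fst_rot] at n₂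
    rw [← r₃, P.emb.fst_rot] at n₃
    have h₂ := R.isOut_rot_of_isOut_symm n₂ hj
    have h₃ := R.isOut_rot_of_isOut_symm n₃ hk
    rw [r₂] at h₂
    rw [r₃] at h₃
    exact (cyc i j k (hi.color_eq (h₂.resolve_left hi.not_symm))
      (hj.color_eq (h₃.resolve_left hj.not_symm))
      hi.mem_edgeSet_symm hj.mem_edgeSet_symm hk.mem_edgeSet_symm).elim

lemma ncard_parentCorners (hn : 4 ≤ Fintype.card V) :
    R.parentCorners.ncard = {f | f ≠ P.outer ∧ ¬ R.IsCyclicFace f}.ncard :=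
  Set.ncard_congr (fun d _ => P.emb.leftFace d)
    (fun _ hd => ⟨R.leftFace_ne_outer hd, R.not_isCyclicFace hd⟩)
    (fun _ _ hd he h => R.leftFace_injOn hd he h)
    (fun _ hf => by simpa only [exists_prop] using R.exists_mem_parentCorners hn hf.1 hf.2)

/-! ### The count -/

lemma ncard_parentCorners_add_numCyclicFaces (hn : 4 ≤ Fintype.card V) :
    R.parentCorners.ncard + R.numCyclicFaces + 1 = Nat.card P.emb.Face := by
  rw [R.ncard_parentCorners hn, numCyclicFaces, ← Set.ncard_union_eq]
  · rw [← Set.ncard_add_ncard_compl {P.outer}, Set.ncard_singleton, add_comm]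
    congr 2
    ext f
    have : R.IsCyclicFace f → f ≠ P.outer := And.left
    simp only [Set.mem_union, Set.mem_ofPred_eq, Set.mem_compl_iff, Set.mem_singleton_iff]
    tauto
  · exact Set.disjoint_left.2 fun f h h' => h.2 h'

open Classical in
lemma sum_inter_add_ncard_leaves :
    ∑ v with P.IsInternalNode v, R.inter v + {p : V × Fin 3 | P.IsInternalNode p.1 ∧
      IsLeafIn (R.tree p.2) (R.root p.2) p.1}.ncard = 3 * {v | P.IsInternalNode v}.ncard := by
  have h : {p : V × Fin 3 | P.IsInternalNode p.1 ∧
      IsLeafIn (R.tree p.2) (R.root p.2) p.1}.ncard = ∑ v with P.IsInternalNode v,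
        ∑ i : Fin 3, if IsLeafIn (R.tree i) (R.root i) v then 1 else 0 := by
    rw [← Finset.sum_product', ← Finset.card_filter, ← Set.ncard_coe_finset]
    congr 1
    ext p
    simp
  rw [h, ← Finset.sum_add_distrib, Set.ncard_eq_toFinset_card', Set.toFinset_ofPred, mul_comm,
    ← smul_eq_mul, ← Finset.sum_const]
  refine Finset.sum_congr rfl fun v _ => ?_
  rw [inter, ← Finset.sum_add_distrib]
  calc _ = ∑ _i : Fin 3, 1 := Finset.sum_congr rfl fun i _ => by split_ifs <;> simp_all
    _ = 3 := by simp

end Realizer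

open Classical in
theorem lemma3 {V : Type*} [Fintype V] (P : PlaneTriangulation V) (R : Realizer P)
    (hn : 4 ≤ Fintype.card V) :
    ((∑ v with P.IsInternalNode v, R.inter v : ℕ) : ℤ) =
      (Fintype.card V : ℤ) + (R.numCyclicFaces : ℤ) - 4 := by
  have h₁ := R.sum_inter_add_ncard_leaves
  have h₂ := R.ncard_leaves
  have h₃ := R.ncard_parentCorners_add_numCyclicFaces hn
  have h₄ := P.card_face
  have h₅ := P.ncard_internalNodes
  omega
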